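/- All hyperbolic spaces below are geodesic metric spaces that are Gromov hyperbolic. An action of a group $G$ by isometries on a metric space $X$ is \emph{acylindrical} if for every $\epsilon>0$ there are constants $M,N\ge 0$ such that for all $x,y\in X$ with $d(x,y)\ge M$ at most $N$ elements $g\in G$ satisfy both $d(x,gx)\le\epsilon$ and $d(y,gy)\le\epsilon$; it is \emph{cobounded} if the translates of some bounded set cover $X$; an action on a hyperbolic space is \emph{non-elementary} if its limit set in the Gromov boundary has more than two points. The group $G$ is \emph{acylindrically hyperbolic} if it admits a non-elementary, acylindrical, cobounded action by isometries on some hyperbolic space. \textbf{Proposition.} Let $G$ be an acylindrically hyperbolic group with no non-trivial finite normal subgroup, and let $X$ be a hyperbolic space with an acylindrical, cobounded action of $G$ by isometries. Then the action of $G$ by homeomorphisms on the Gromov boundary $\partial X$ is (1) minimal: every $G$-orbit in $\partial X$ is dense in $\partial X$; (2) strongly proximal: for any two Borel probability measures $\mu_1,\mu_2$ on $\partial X$ there is a sequence $(t_n)$ of elements of $G$ such that $t_n\mu_1$ and $t_n\mu_2$ converge weakly to a common Borel probability measure on $\partial X$; (3) topologically free: for every $g\in G\setminus\{1\}$ the set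 of fixed points of $g$ in $\partial X$ has empty interior. -/

import Mathlib

open Filter Topology MeasureTheory

universe u v w

noncomputable section

/-! ### Gromov hyperbolic geodesic spaces -/

/-- The Gromov product `(x · y)_p`. -/
def gromovProduct {X : Type v} [MetricSpace X] (p x y : X) : ℝ :=
  (dist x p + dist y p - dist x y) / 2

/-- Gromov's four-point definition of hyperbolicity, for some constant `δ`. -/
class IsGromovHyperbolic (X : Type v) [MetricSpace X] : Prop where
  exists_delta : ∃ δ : ℝ, 0 ≤ δ ∧ ∀ p x y z : X,
    min (gromovProduct p x y) (gromovProduct p y z) - δ ≤ gromovProduct p x z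

/-- Any two points are joined by a geodesic segment, that is, by an isometrically embedded
interval. -/
class IsGeodesicSpace (X : Type v) [MetricSpace X] : Prop where
  exists_geodesic : ∀ x y : X, ∃ c : ℝ → X, c 0 = x ∧ c (dist x y) = y ∧
    ∀ s ∈ Set.Icc 0 (dist x y), ∀ t ∈ Set.Icc 0 (dist x y), dist (c s) (c t) = |s - t|

/-! ### The Gromov boundary -/

/-- `(x_i · y_j)_p → ∞` as `i, j → ∞`. Whether this holds does not depend on `p`. -/
def GromovProductTendsto {X : Type v} [MetricSpace X] (x y : ℕ → X) : Prop :=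
  ∀ p : X, Tendsto (fun ij : ℕ × ℕ => gromovProduct p (x ij.1) (y ij.2)) atTop atTop

/-- Sequences `x` in `X` that converge at infinity: `(x_i · x_j)_p → ∞` as `i, j → ∞`. -/
def SeqAtInfinity (X : Type v) [MetricSpace X] : Type v :=
  {x : ℕ → X // GromovProductTendsto x x}

theorem gromovProduct_comm {X : Type v} [MetricSpace X] (p x y : X) :
    gromovProduct p x y = gromovProduct p y x := by
  unfold gromovProduct
  rw [dist_comm x y]
  ring

theorem GromovProductTendsto.symm {X : Type v} [MetricSpace X] {x y : ℕ → X}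
    (h : GromovProductTendsto x y) : GromovProductTendsto y x := by
  intro p
  rw [tendsto_atTop]
  intro r
  obtain ⟨⟨a, b⟩, h1⟩ := eventually_atTop.1 (tendsto_atTop.1 (h p) r)
  refine eventually_atTop.2 ⟨(b, a), fun ij hij => ?_⟩
  rw [gromovProduct_comm]
  exact h1 (ij.2, ij.1) ⟨hij.2, hij.1⟩

theorem GromovProductTendsto.trans {X : Type v} [MetricSpace X] [IsGromovHyperbolic X]
    {x y z : ℕ → X} (hxy : GromovProductTendsto x y) (hyz : GromovProductTendsto y z) :
    GromovProductTendsto x z := by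
  obtain ⟨δ, -, hδ⟩ := IsGromovHyperbolic.exists_delta (X := X)
  intro p
  rw [tendsto_atTop]
  intro r
  obtain ⟨⟨a, b⟩, h1⟩ := eventually_atTop.1 (tendsto_atTop.1 (hxy p) (r + δ))
  obtain ⟨⟨c, d⟩, h2⟩ := eventually_atTop.1 (tendsto_atTop.1 (hyz p) (r + δ))
  refine eventually_atTop.2 ⟨(a, d), fun ij hij => ?_⟩
  have h3 := h1 (ij.1, max b c) ⟨hij.1, le_max_left _ _⟩
  have h4 := h2 (max b c, ij.2) ⟨le_max_right _ _, hij.2⟩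
  have h5 := hδ p (x ij.1) (y (max b c)) (z ij.2)
  have h6 := le_min h3 h4
  dsimp only at h6
  linarith

/-- Two sequences converging at infinity are equivalent when `(x_i · y_j)_p → ∞`. -/
instance SeqAtInfinity.setoid (X : Type v) [MetricSpace X] [IsGromovHyperbolic X] :
    Setoid (SeqAtInfinity X) where
  r x y := GromovProductTendsto x.1 y.1
  iseqv := ⟨fun x => x.2, fun h => h.symm, fun h h' => h.trans h'⟩

/-- The Gromov boundary `∂X`. -/
def GromovBoundary (X : Type v) [MetricSpace X] [IsGromovHyperbolic X] : Type v :=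
  Quotient (SeqAtInfinity.setoid X)

namespace GromovBoundary

/-- The boundary point represented by a sequence converging at infinity. -/
def mk {X : Type v} [MetricSpace X] [IsGromovHyperbolic X] (x : SeqAtInfinity X) :
    GromovBoundary X :=
  Quotient.mk _ x

/-- The Gromov product of two boundary points,
`(ξ · η)_p = sup liminf_{i, j → ∞} (x_i · y_j)_p`, the supremum being over all sequences `x`, `y`
representing `ξ`, `η`. Its value lies in the extended reals. -/
def product {X : Type v} [MetricSpace X] [IsGromovHyperbolic X] (p : X)
    (ξ η : GromovBoundary X) : EReal :=
  ⨆ (x : SeqAtInfinity X) (y : SeqAtInfinity X) (_ : mk x = ξ) (_ : mk y = η),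
    liminf (fun ij : ℕ × ℕ => ((gromovProduct p (x.1 ij.1) (y.1 ij.2) : ℝ) : EReal)) atTop

/-- The usual topology of `∂X`, in which the sets `{η | r ≤ (ξ · η)_p}`, `r ∈ ℝ`, form a basis of
neighbourhoods of `ξ`. Gromov products based at `p` and at `q` differ by at most `dist p q`, so
that asking for one base point `p` or for all of them is the same. -/
instance topologicalSpace (X : Type v) [MetricSpace X] [IsGromovHyperbolic X] :
    TopologicalSpace (GromovBoundary X) where
  IsOpen U := ∀ ξ ∈ U, ∀ p : X, ∃ r : ℝ, {η | (r : EReal) ≤ product p ξ η} ⊆ U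
  isOpen_univ := fun _ _ _ => ⟨0, Set.subset_univ _⟩
  isOpen_inter := by
    intro U V hU hV ξ hξ p
    obtain ⟨r, hr⟩ := hU ξ hξ.1 p
    obtain ⟨s, hs⟩ := hV ξ hξ.2 p
    refine ⟨max r s, fun η hη => ⟨hr ?_, hs ?_⟩⟩
    · exact le_trans (EReal.coe_le_coe_iff.2 (le_max_left r s)) hη
    · exact le_trans (EReal.coe_le_coe_iff.2 (le_max_right r s)) hη
  isOpen_sUnion := by
    intro S hS ξ hξ p
    obtain ⟨U, hU, hξU⟩ := hξ
    obtain ⟨r, hr⟩ := hS U hU ξ hξU p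
    exact ⟨r, hr.trans (Set.subset_sUnion_of_mem hU)⟩

/-- `∂X` carries its Borel `σ`-algebra. -/
instance measurableSpace (X : Type v) [MetricSpace X] [IsGromovHyperbolic X] :
    MeasurableSpace (GromovBoundary X) :=
  borel _

instance borelSpace (X : Type v) [MetricSpace X] [IsGromovHyperbolic X] :
    BorelSpace (GromovBoundary X) :=
  ⟨rfl⟩

end GromovBoundary

/-! ### The action on the boundary -/

section Action

variable {G : Type u} [Group G] {X : Type v} [MetricSpace X] [MulAction G X] [IsIsometricSMul G X]

theorem gromovProduct_smul (g : G) (p x y : X) :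
    gromovProduct (g • p) (g • x) (g • y) = gromovProduct p x y := by
  simp [gromovProduct]

theorem GromovProductTendsto.smul (g : G) {x y : ℕ → X} (h : GromovProductTendsto x y) :
    GromovProductTendsto (fun n => g • x n) (fun n => g • y n) := by
  intro p
  refine (h (g⁻¹ • p)).congr fun ij => ?_
  rw [← gromovProduct_smul g, smul_inv_smul]

/-- An isometry moves a sequence converging at infinity termwise. -/
def SeqAtInfinity.translate (g : G) (x : SeqAtInfinity X) : SeqAtInfinity X :=
  ⟨fun n => g • x.1 n, x.2.smul g⟩

variable [IsGromovHyperbolic X]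

/-- The action of `G` on `∂X` induced by an isometric action on `X`: `g • [x_n] = [g • x_n]`. -/
instance GromovBoundary.mulAction : MulAction G (GromovBoundary X) where
  smul g ξ := Quotient.map (SeqAtInfinity.translate g)
    (fun _ _ h => GromovProductTendsto.smul g h) ξ
  one_smul ξ := by
    induction ξ using Quotient.inductionOn with
    | h x => exact congrArg (Quotient.mk _) (Subtype.ext (funext fun n => one_smul G (x.1 n)))
  mul_smul g h ξ := by
    induction ξ using Quotient.inductionOn with
    | h x => exact congrArg (Quotient.mk _) (Subtype.ext (funext fun n => mul_smul g h (x.1 n)))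

theorem GromovBoundary.smul_mk (g : G) (x : SeqAtInfinity X) :
    g • GromovBoundary.mk x = GromovBoundary.mk (SeqAtInfinity.translate g x) :=
  rfl

theorem GromovBoundary.product_le_product_smul (g : G) (p : X) (ξ η : GromovBoundary X) :
    GromovBoundary.product p ξ η ≤ GromovBoundary.product (g • p) (g • ξ) (g • η) := by
  unfold GromovBoundary.product
  refine iSup_le fun x => iSup_le fun y => iSup_le fun hx => iSup_le fun hy => ?_
  refine le_iSup_of_le (SeqAtInfinity.translate g x) (le_iSup_of_le (SeqAtInfinity.translate g y)
    (le_iSup_of_le ?_ (le_iSup_of_le ?_ ?_)))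
  · rw [← hx, GromovBoundary.smul_mk]
  · rw [← hy, GromovBoundary.smul_mk]
  · simp only [SeqAtInfinity.translate, gromovProduct_smul, le_refl]

/-- `G` acts on `∂X` by homeomorphisms. -/
instance GromovBoundary.continuousConstSMul : ContinuousConstSMul G (GromovBoundary X) where
  continuous_const_smul g := by
    refine ⟨fun U hU ξ hξ p => ?_⟩
    obtain ⟨r, hr⟩ := hU (g • ξ) hξ (g • p)
    exact ⟨r, fun η hη => hr (le_trans hη (GromovBoundary.product_le_product_smul g p ξ η))⟩

end Action

/-! ### Acylindrical actions and acylindrically hyperbolic groups -/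

/-- The action of `G` on `X` is acylindrical. -/
def IsAcylindricalAction (G : Type u) [Group G] (X : Type v) [MetricSpace X] [MulAction G X] :
    Prop :=
  ∀ ε : ℝ, 0 < ε → ∃ (M : ℝ) (N : ℕ), ∀ x y : X, M ≤ dist x y →
    {g : G | dist x (g • x) ≤ ε ∧ dist y (g • y) ≤ ε}.encard ≤ N

/-- The action of `G` on `X` is cobounded: the translates of some bounded set cover `X`. -/
def IsCoboundedAction (G : Type u) [Group G] (X : Type v) [MetricSpace X] [MulAction G X] :
    Prop :=
  ∃ B : Set X, Bornology.IsBounded B ∧ ∀ x : X, ∃ g : G, ∃ b ∈ B, g • b = x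

/-- The limit set of `G` in `∂X`: the boundary points that are limits of sequences in an orbit. -/
def gromovLimitSet (G : Type u) [Group G] (X : Type v) [MetricSpace X] [IsGromovHyperbolic X]
    [MulAction G X] : Set (GromovBoundary X) :=
  {ξ | ∃ (p : X) (t : ℕ → G) (ht : GromovProductTendsto (fun n => t n • p) (fun n => t n • p)),
    GromovBoundary.mk ⟨fun n => t n • p, ht⟩ = ξ}

/-- The action of `G` on `X` is non-elementary: its limit set has more than two points. -/
def IsNonElementaryAction (G : Type u) [Group G] (X : Type v) [MetricSpace X]
    [IsGromovHyperbolic X] [MulAction G X] : Prop :=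
  2 < (gromovLimitSet G X).encard

/-- `G` is acylindrically hyperbolic: it admits a non-elementary, acylindrical, cobounded action by
isometries on a (geodesic) hyperbolic space. -/
def IsAcylindricallyHyperbolic (G : Type u) [Group G] : Prop :=
  ∃ (Y : Type w) (_ : MetricSpace Y) (_ : IsGromovHyperbolic Y) (_ : IsGeodesicSpace Y)
    (_ : MulAction G Y) (_ : IsIsometricSMul G Y),
    IsNonElementaryAction G Y ∧ IsAcylindricalAction G Y ∧ IsCoboundedAction G Y

/-! ### Dynamics of actions by homeomorphisms -/

/-- The action of `G` on `B` is proximal: for all `x`, `y` there is a sequence `(t_n)` in `G` such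
that `t_n x` and `t_n y` converge to a common limit. -/
def IsProximalAction (G : Type u) [Group G] (B : Type v) [TopologicalSpace B] [MulAction G B] :
    Prop :=
  ∀ x y : B, ∃ (t : ℕ → G) (z : B),
    Tendsto (fun n => t n • x) atTop (𝓝 z) ∧ Tendsto (fun n => t n • y) atTop (𝓝 z)

/-- The action of `G` on Borel probability measures on `B` by push-forward. -/
instance probabilityMeasureMulAction {G : Type u} [Group G] {B : Type v} [TopologicalSpace B]
    [MulAction G B] [ContinuousConstSMul G B] [MeasurableSpace B] [BorelSpace B] :
    MulAction G (ProbabilityMeasure B) where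
  smul g μ := μ.map (f := fun b => g • b) (continuous_const_smul g).measurable.aemeasurable
  one_smul μ := by
    apply Subtype.ext
    change Measure.map (fun b => (1 : G) • b) (μ : Measure B) = μ
    simp
  mul_smul g h μ := by
    apply Subtype.ext
    change Measure.map (fun b => (g * h) • b) (μ : Measure B) =
      Measure.map (fun b => g • b) (Measure.map (fun b => h • b) (μ : Measure B))
    rw [Measure.map_map (continuous_const_smul g).measurable (continuous_const_smul h).measurable]
    congr 1
    funext b
    exact mul_smul g h b

/-- The action of `G` on `B` is strongly proximal: the action on the space of Borel probability
measures on `B`, with the topology of weak convergence, is proximal. -/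
def IsStronglyProximalAction (G : Type u) [Group G] (B : Type v) [TopologicalSpace B]
    [MulAction G B] [ContinuousConstSMul G B] [MeasurableSpace B] [BorelSpace B] : Prop :=
  IsProximalAction G (ProbabilityMeasure B)

/-- The action of `G` on `B` is topologically free: the fixed point set of every `g ≠ 1` has empty
interior. -/
def IsTopologicallyFreeAction (G : Type u) [Group G] (B : Type v) [TopologicalSpace B]
    [MulAction G B] : Prop :=
  ∀ g : G, g ≠ 1 → interior (MulAction.fixedBy B g) = ∅

end

/-!
The argument works with sequences `g n` in `G` such that `g n • p` and `(g n)⁻¹ • p` converge to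
boundary points `ξ` and `η`. For such a sequence, `g n` maps the complement of any neighbourhood
of `η` into any given neighbourhood of `ξ` (`TendstoBoundary.eventually_smul_mem`). No loxodromic
elements and no classification of actions are needed.

Acylindricity enters through commutators. If a subgroup `H` almost fixes the directions from `p`
to points `u n` tending to infinity, then each `h ∈ H` translates the geodesic from `p` to `u n`
coarsely along itself, so that commutators of elements of `H` move long stretches of it by a
bounded amount; hence `H` has finitely many commutators
(`IsAcylindricalAction.finite_commutators`). On the other hand, if a subgroup of finite index has
finitely many commutators, then it fixes every limit point of `G` in any hyperbolic space on which
`G` acts, and as the fixed points of a group with unbounded orbits number at most two, the action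
is elementary (`not_isNonElementaryAction_of_finite_commutators`). An acylindrically hyperbolic
group therefore has no such subgroup. Two consequences follow for the space `X`. Every orbit in
`∂X` is infinite (`IsAcylindricalAction.infinite_orbit`). Every `ζ ∈ ∂X` is the limit of both
`g n • p` and `(g n)⁻¹ • p` for some sequence (`exists_tendstoBoundary_smul_and_inv_smul`): choose
`a n • p → ζ` by coboundedness and conjugate by `a n` an element `h` that does not almost fix the
directions from `p` to `(a n)⁻¹ • p`.

* Minimality: such a sequence for `ζ` moves any other boundary point to `ζ`.
* Strong proximality: for finitely many distinct points `f • ζ` in the orbit there are disjoint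
  neighbourhoods, one of which has small mass. The element `g n * f⁻¹` then moves almost all of
  the mass close to `ζ`, so that suitable elements push both measures to the Dirac mass at `ζ`.
  The boundary need be neither compact nor separable for this.
* Topological freeness: if `k` fixes a neighbourhood of `ζ`, then `(g n)⁻¹ * k * g n` eventually
  fixes any given point other than `ζ`. Only finitely many elements fix three given points, so one
  of these conjugates occurs infinitely often; it fixes `∂X` pointwise. The kernel of the action
  on `∂X` is a finite normal subgroup, hence trivial.
-/

open scoped commutatorElement

/-! ### Gromov products of points -/

section GromovProduct

variable {X : Type v} [MetricSpace X]

theorem gromovProduct_self (p x : X) : gromovProduct p x x = dist x p := by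
  simp [gromovProduct]

theorem gromovProduct_le_add_dist_base (p q x y : X) :
    gromovProduct p x y ≤ gromovProduct q x y + dist p q := by
  unfold gromovProduct
  linarith [dist_triangle_right x p q, dist_triangle_right y p q]

theorem gromovProduct_le_add_dist (p x x' y y' : X) :
    gromovProduct p x y ≤ gromovProduct p x' y' + dist x x' + dist y y' := by
  unfold gromovProduct
  linarith [dist_triangle x x' p, dist_triangle y y' p, dist_triangle_left x' y' x,
    dist_triangle x y y']

theorem gromovProduct_add_gromovProduct (p q x : X) :
    gromovProduct p q x + gromovProduct q p x = dist p q := by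
  unfold gromovProduct
  rw [dist_comm q p, dist_comm x p, dist_comm x q]
  ring

/-- The four-point inequality with constant `δ`. -/
def IsHyperbolicWith (X : Type v) [MetricSpace X] (δ : ℝ) : Prop :=
  0 ≤ δ ∧ ∀ p x y z : X, min (gromovProduct p x y) (gromovProduct p y z) - δ ≤ gromovProduct p x z

theorem IsGromovHyperbolic.exists_isHyperbolicWith (X : Type v) [MetricSpace X]
    [IsGromovHyperbolic X] : ∃ δ, IsHyperbolicWith X δ :=
  IsGromovHyperbolic.exists_delta

theorem IsHyperbolicWith.sub_le {δ r : ℝ} (hδ : IsHyperbolicWith X δ) {p x y z : X}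
    (hxy : r ≤ gromovProduct p x y) (hyz : r ≤ gromovProduct p y z) :
    r - δ ≤ gromovProduct p x z := by
  linarith [hδ.2 p x y z, le_min hxy hyz]

theorem IsHyperbolicWith.sub_le_of_three {δ r : ℝ} (hδ : IsHyperbolicWith X δ) {p x y z t : X}
    (hxy : r ≤ gromovProduct p x y) (hyz : r ≤ gromovProduct p y z)
    (hzt : r ≤ gromovProduct p z t) : r - 2 * δ ≤ gromovProduct p x t := by
  have h := hδ.sub_le (hδ.sub_le hxy hyz) (by linarith [hδ.1] : r - δ ≤ gromovProduct p z t)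
  linarith

/-- Two coarse centres of one triangle are close to each other. -/
theorem IsHyperbolicWith.dist_le_of_centers {δ R : ℝ} (hδ : IsHyperbolicWith X δ) {p q x y z : X}
    (hpxy : gromovProduct p x y ≤ R) (hpxz : gromovProduct p x z ≤ R)
    (hpyz : gromovProduct p y z ≤ R) (hqxy : gromovProduct q x y ≤ R)
    (hqxz : gromovProduct q x z ≤ R) (hqyz : gromovProduct q y z ≤ R) :
    dist p q ≤ 2 * R + 2 * δ := by
  -- Of two vertices seen from `p` with a small product, at least one looks away from `q`.
  have away : ∀ a b : X, gromovProduct p a b ≤ R →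
      gromovProduct p q a ≤ R + δ ∨ gromovProduct p q b ≤ R + δ := by
    intro a b hab
    by_contra! h
    have h1 := hδ.2 p a q b
    rw [gromovProduct_comm p a q] at h1
    linarith [lt_min h.1 h.2]
  have close : ∀ a b : X, gromovProduct p q a ≤ R + δ → gromovProduct p q b ≤ R + δ →
      gromovProduct q a b ≤ R → dist p q ≤ 2 * R + 2 * δ := by
    intro a b ha hb hab
    have ha' := gromovProduct_add_gromovProduct p q a
    have hb' := gromovProduct_add_gromovProduct p q b
    have h1 := hδ.2 q a p b
    rw [gromovProduct_comm q a p] at h1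
    have h2 : dist p q - (R + δ) ≤ min (gromovProduct q p a) (gromovProduct q p b) :=
      le_min (by linarith) (by linarith)
    linarith
  rcases away x y hpxy with hx | hy
  · rcases away y z hpyz with hy | hz
    · exact close x y hx hy hqxy
    · exact close x z hx hz hqxz
  · rcases away x z hpxz with hx | hz
    · exact close x y hx hy hqxy
    · exact close y z hy hz hqyz

end GromovProduct

/-! ### Sequences converging at infinity -/

section Sequences

variable {X : Type v} [MetricSpace X]

theorem GromovProductTendsto.exists_forall_le {x y : ℕ → X} (h : GromovProductTendsto x y) (p : X)
    (r : ℝ) : ∃ n, ∀ i ≥ n, ∀ j ≥ n, r ≤ gromovProduct p (x i) (y j) := by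
  obtain ⟨⟨a, b⟩, h1⟩ := eventually_atTop.1 (tendsto_atTop.1 (h p) r)
  exact ⟨max a b, fun i hi j hj =>
    h1 (i, j) ⟨le_trans (le_max_left _ _) hi, le_trans (le_max_right _ _) hj⟩⟩

theorem GromovProductTendsto.of_forall_exists {x y : ℕ → X} (p : X)
    (h : ∀ r : ℝ, ∃ n, ∀ i ≥ n, ∀ j ≥ n, r ≤ gromovProduct p (x i) (y j)) :
    GromovProductTendsto x y := by
  intro q
  rw [tendsto_atTop]
  intro r
  obtain ⟨n, hn⟩ := h (r + dist p q)
  refine eventually_atTop.2 ⟨(n, n), fun ij hij => ?_⟩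
  linarith [hn ij.1 hij.1 ij.2 hij.2, gromovProduct_le_add_dist_base p q (x ij.1) (y ij.2)]

theorem GromovProductTendsto.of_dist_le {x x' y y' : ℕ → X} (h : GromovProductTendsto x y) {C : ℝ}
    (hx : ∀ n, dist (x n) (x' n) ≤ C) (hy : ∀ n, dist (y n) (y' n) ≤ C) :
    GromovProductTendsto x' y' := by
  refine .of_forall_exists (x 0) fun r => ?_
  obtain ⟨n, hn⟩ := h.exists_forall_le (x 0) (r + C + C)
  exact ⟨n, fun i hi j hj => by
    linarith [hn i hi j hj, gromovProduct_le_add_dist (x 0) (x i) (x' i) (y j) (y' j), hx i, hy j]⟩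

theorem GromovProductTendsto.tendsto_dist {x : ℕ → X} (h : GromovProductTendsto x x) (p : X) :
    Tendsto (fun n => dist p (x n)) atTop atTop := by
  refine tendsto_atTop.2 fun r => ?_
  obtain ⟨n, hn⟩ := h.exists_forall_le p r
  filter_upwards [eventually_ge_atTop n] with i hi
  have := hn i hi i hi
  rwa [gromovProduct_self, dist_comm] at this

/-- The Gromov products of two sequences that converge to different points at infinity are
bounded. -/
theorem exists_forall_gromovProduct_le [IsGromovHyperbolic X] {x y : ℕ → X}
    (hx : GromovProductTendsto x x) (hy : GromovProductTendsto y y)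
    (hxy : ¬ GromovProductTendsto x y) (p : X) :
    ∃ (R : ℝ) (n : ℕ), ∀ i ≥ n, ∀ j ≥ n, gromovProduct p (x i) (y j) ≤ R := by
  obtain ⟨δ, hδ⟩ := IsGromovHyperbolic.exists_isHyperbolicWith X
  by_contra! hunb
  refine hxy (.of_forall_exists p fun r => ?_)
  obtain ⟨a, ha⟩ := hx.exists_forall_le p (r + 2 * δ)
  obtain ⟨b, hb⟩ := hy.exists_forall_le p (r + 2 * δ)
  obtain ⟨i, hi, j, hj, hij⟩ := hunb (r + 2 * δ) (max a b)
  refine ⟨max a b, fun k hk l hl => ?_⟩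
  linarith [hδ.sub_le_of_three (ha k (le_of_max_le_left hk) i (le_of_max_le_left hi)) hij.le
    (hb j (le_of_max_le_right hj) l (le_of_max_le_right hl))]

end Sequences

/-! ### The topology of the boundary -/

namespace GromovBoundary

variable {X : Type v} [MetricSpace X] [IsGromovHyperbolic X]

theorem mk_eq_mk {x y : SeqAtInfinity X} : mk x = mk y ↔ GromovProductTendsto x.1 y.1 :=
  Quotient.eq

theorem exists_mk_eq (ξ : GromovBoundary X) : ∃ x, mk x = ξ :=
  Quotient.exists_rep ξ

theorem le_product {p : X} {x y : SeqAtInfinity X} {r : ℝ} {n : ℕ}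
    (h : ∀ i ≥ n, ∀ j ≥ n, r ≤ gromovProduct p (x.1 i) (y.1 j)) :
    (r : EReal) ≤ product p (mk x) (mk y) := by
  unfold product
  refine le_iSup_of_le x (le_iSup_of_le y (le_iSup_of_le rfl (le_iSup_of_le rfl ?_)))
  refine le_liminf_of_le (by isBoundedDefault) (eventually_atTop.2 ⟨(n, n), fun ij hij => ?_⟩)
  exact EReal.coe_le_coe_iff.2 (h ij.1 hij.1 ij.2 hij.2)

/-- Up to an additive error, the Gromov product of two boundary points can be computed from any
sequences representing them. -/
theorem exists_forall_le_of_le_product {δ : ℝ} (hδ : IsHyperbolicWith X δ) {p : X}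
    {x y : SeqAtInfinity X} {r : ℝ} (h : (r : EReal) ≤ product p (mk x) (mk y)) :
    ∃ n, ∀ i ≥ n, ∀ j ≥ n, r - (1 + 2 * δ) ≤ gromovProduct p (x.1 i) (y.1 j) := by
  have hlt : ((r - 1 : ℝ) : EReal) < product p (mk x) (mk y) :=
    lt_of_lt_of_le (EReal.coe_lt_coe_iff.2 (by linarith)) h
  unfold product at hlt
  simp only [lt_iSup_iff] at hlt
  obtain ⟨x', y', hx, hy, hlt⟩ := hlt
  obtain ⟨⟨a, b⟩, hab⟩ := eventually_atTop.1 (eventually_lt_of_lt_liminf hlt)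
  obtain ⟨c, hc⟩ := (mk_eq_mk.1 hx).symm.exists_forall_le p (r - 1)
  obtain ⟨d, hd⟩ := (mk_eq_mk.1 hy).exists_forall_le p (r - 1)
  refine ⟨max c d, fun i hi j hj => ?_⟩
  have h1 := hc i (le_of_max_le_left hi) (max a c) (le_max_right _ _)
  have h2 := EReal.coe_lt_coe_iff.1 (hab (max a c, max b d) ⟨le_max_left _ _, le_max_left _ _⟩)
  have h3 := hd (max b d) (le_max_right _ _) j (le_of_max_le_right hj)
  linarith [hδ.sub_le_of_three h1 h2.le h3]

theorem le_product_self (p : X) (ξ : GromovBoundary X) (r : ℝ) : (r : EReal) ≤ product p ξ ξ := by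
  obtain ⟨x, rfl⟩ := exists_mk_eq ξ
  obtain ⟨n, hn⟩ := x.2.exists_forall_le p r
  exact le_product hn

theorem le_product_trans {δ : ℝ} (hδ : IsHyperbolicWith X δ) {p : X} {ξ η ζ : GromovBoundary X}
    {r : ℝ} (h : ((r + (1 + 3 * δ) : ℝ) : EReal) ≤ product p ξ η)
    (h' : ((r + (1 + 3 * δ) : ℝ) : EReal) ≤ product p η ζ) : (r : EReal) ≤ product p ξ ζ := by
  obtain ⟨x, rfl⟩ := exists_mk_eq ξ
  obtain ⟨y, rfl⟩ := exists_mk_eq η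
  obtain ⟨z, rfl⟩ := exists_mk_eq ζ
  obtain ⟨m, hm⟩ := exists_forall_le_of_le_product hδ h
  obtain ⟨n, hn⟩ := exists_forall_le_of_le_product hδ h'
  refine le_product (n := max m n) fun i hi j hj => ?_
  linarith [hδ.sub_le (hm i (le_of_max_le_left hi) (max m n) (le_max_left _ _))
    (hn (max m n) (le_max_right _ _) j (le_of_max_le_right hj))]

theorem le_product_of_le_product_base {δ : ℝ} (hδ : IsHyperbolicWith X δ) {p q : X}
    {ξ η : GromovBoundary X} {r : ℝ}
    (h : ((r + dist q p + (1 + 2 * δ) : ℝ) : EReal) ≤ product q ξ η) :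
    (r : EReal) ≤ product p ξ η := by
  obtain ⟨x, rfl⟩ := exists_mk_eq ξ
  obtain ⟨y, rfl⟩ := exists_mk_eq η
  obtain ⟨m, hm⟩ := exists_forall_le_of_le_product hδ h
  refine le_product (n := m) fun i hi j hj => ?_
  linarith [hm i hi j hj, gromovProduct_le_add_dist_base q p (x.1 i) (y.1 j)]

theorem setOf_le_product_mem_nhds (p : X) (ξ : GromovBoundary X) (r : ℝ) :
    {η | (r : EReal) ≤ product p ξ η} ∈ 𝓝 ξ := by
  obtain ⟨δ, hδ⟩ := IsGromovHyperbolic.exists_isHyperbolicWith X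
  refine mem_nhds_iff.2 ⟨{ζ | ∃ s : ℝ, {η | (s : EReal) ≤ product p ζ η} ⊆
    {η | (r : EReal) ≤ product p ξ η}}, fun ζ ⟨s, hs⟩ => hs (le_product_self p ζ s), ?_,
    ⟨r, subset_rfl⟩⟩
  rintro ζ ⟨s, hs⟩ q
  refine ⟨s + (1 + 3 * δ) + dist q p + (1 + 2 * δ), fun η hη => ⟨s + (1 + 3 * δ), fun θ hθ => ?_⟩⟩
  exact hs (le_product_trans hδ (le_product_of_le_product_base hδ hη) hθ)

theorem exists_setOf_le_product_subset (p : X) {ξ : GromovBoundary X} {V : Set (GromovBoundary X)}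
    (hV : V ∈ 𝓝 ξ) : ∃ r : ℝ, {η | (r : EReal) ≤ product p ξ η} ⊆ V := by
  obtain ⟨U, hUV, hU, hξ⟩ := mem_nhds_iff.1 hV
  obtain ⟨r, hr⟩ := hU ξ hξ p
  exact ⟨r, hr.trans hUV⟩

instance t2Space : T2Space (GromovBoundary X) := by
  obtain ⟨δ, hδ⟩ := IsGromovHyperbolic.exists_isHyperbolicWith X
  refine t2_iff_nhds.2 fun {ξ η} hne => ?_
  by_contra heq
  obtain ⟨x, rfl⟩ := exists_mk_eq ξ
  obtain ⟨y, rfl⟩ := exists_mk_eq η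
  obtain ⟨R, n, hn⟩ := exists_forall_gromovProduct_le x.2 y.2 (fun h => heq (mk_eq_mk.2 h)) (x.1 0)
  have hmem := inter_mem_inf (setOf_le_product_mem_nhds (x.1 0) (mk x) (R + 1 + δ + (1 + 2 * δ)))
    (setOf_le_product_mem_nhds (x.1 0) (mk y) (R + 1 + δ + (1 + 2 * δ)))
  obtain ⟨ζ, hxζ, hyζ⟩ := hne.nonempty_of_mem hmem
  obtain ⟨z, rfl⟩ := exists_mk_eq ζ
  obtain ⟨a, ha⟩ := exists_forall_le_of_le_product hδ hxζ
  obtain ⟨b, hb⟩ := exists_forall_le_of_le_product hδ hyζ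
  set k := max n (max a b)
  have hka : a ≤ k := (le_max_left _ _).trans (le_max_right _ _)
  have hkb : b ≤ k := (le_max_right _ _).trans (le_max_right _ _)
  have h1 := ha k hka k hka
  have h2 := hb k hkb k hkb
  rw [gromovProduct_comm] at h2
  have h3 := hδ.sub_le h1 (by linarith : _ ≤ gromovProduct _ _ _)
  linarith [hn k (le_max_left _ _) k (le_max_left _ _)]

end GromovBoundary

/-- The sequence `x` in `X` converges to the boundary point `ξ`. -/
def TendstoBoundary {X : Type v} [MetricSpace X] [IsGromovHyperbolic X] (x : ℕ → X)
    (ξ : GromovBoundary X) : Prop :=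
  ∃ h : GromovProductTendsto x x, GromovBoundary.mk ⟨x, h⟩ = ξ

section Tendsto

variable {X : Type v} [MetricSpace X] [IsGromovHyperbolic X]

theorem TendstoBoundary.of_gromovProductTendsto {x y : ℕ → X} {ξ : GromovBoundary X}
    (hx : TendstoBoundary x ξ) (hxy : GromovProductTendsto x y) : TendstoBoundary y ξ := by
  obtain ⟨hx, rfl⟩ := hx
  exact ⟨hxy.symm.trans hxy, GromovBoundary.mk_eq_mk.2 hxy.symm⟩

theorem TendstoBoundary.comp_strictMono {x : ℕ → X} {ξ : GromovBoundary X}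
    (hx : TendstoBoundary x ξ) {φ : ℕ → ℕ} (hφ : StrictMono φ) :
    TendstoBoundary (fun n => x (φ n)) ξ := by
  refine hx.of_gromovProductTendsto (.of_forall_exists (x 0) fun r => ?_)
  obtain ⟨n, hn⟩ := hx.1.exists_forall_le (x 0) r
  exact ⟨n, fun i hi j hj => hn i hi (φ j) (hj.le.trans (hφ.id_le j))⟩

end Tendsto

/-! ### Isometries that almost fix a direction -/

/-- `c` parametrises a geodesic segment from `x` to `y` by arc length on `[0, dist x y]`. -/
def IsGeodesicSegment {X : Type v} [MetricSpace X] (c : ℝ → X) (x y : X) : Prop :=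
  c 0 = x ∧ c (dist x y) = y ∧
    ∀ s ∈ Set.Icc 0 (dist x y), ∀ t ∈ Set.Icc 0 (dist x y), dist (c s) (c t) = |s - t|

section Geodesics

variable {X : Type v} [MetricSpace X]

theorem IsGeodesicSegment.dist_left {c : ℝ → X} {x y : X} (hc : IsGeodesicSegment c x y) {s : ℝ}
    (h0 : 0 ≤ s) (h1 : s ≤ dist x y) : dist x (c s) = s := by
  have h := hc.2.2 0 ⟨le_rfl, dist_nonneg⟩ s ⟨h0, h1⟩
  rwa [hc.1, zero_sub, abs_neg, abs_of_nonneg h0] at h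

theorem IsGeodesicSegment.dist_right {c : ℝ → X} {x y : X} (hc : IsGeodesicSegment c x y) {s : ℝ}
    (h0 : 0 ≤ s) (h1 : s ≤ dist x y) : dist (c s) y = dist x y - s := by
  have h := hc.2.2 s ⟨h0, h1⟩ (dist x y) ⟨dist_nonneg, le_rfl⟩
  rwa [hc.2.1, abs_sub_comm, abs_of_nonneg (by linarith)] at h

variable {G : Type u} [Group G] [MulAction G X] [IsIsometricSMul G X]

theorem dist_inv_smul_self (p : X) (g : G) : dist p (g⁻¹ • p) = dist p (g • p) := by
  rw [← dist_smul g, smul_inv_smul, dist_comm]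

/-- An isometry that almost fixes the direction from `p` to `u` translates the middle part of a
geodesic from `p` to `u` coarsely along itself, by `dist p (g • u) - dist p u`. -/
theorem IsHyperbolicWith.exists_dist_smul_le {δ : ℝ} (hδ : IsHyperbolicWith X δ) {c : ℝ → X}
    {p u : X} (hc : IsGeodesicSegment c p u) {g : G} {D s : ℝ} (hD : dist p (g • p) ≤ D)
    (hs : D + δ < s) (hsu : s + D ≤ dist p u) (hg : s + D ≤ gromovProduct p u (g • u)) :
    ∃ t, |t - s - (dist p (g • u) - dist p u)| ≤ 2 * δ ∧ |t - s| ≤ D ∧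
      dist (g • c s) (c t) ≤ 6 * δ := by
  have hδ0 := hδ.1
  have hD0 : 0 ≤ D := dist_nonneg.trans hD
  have hpx : dist (g • p) (g • c s) = s := by
    rw [dist_smul, hc.dist_left (by linarith) (by linarith)]
  have hxu : dist (g • c s) (g • u) = dist p u - s := by
    rw [dist_smul, hc.dist_right (by linarith) (by linarith)]
  have hpu : dist (g • p) (g • u) = dist p u := dist_smul _ _ _
  set t := dist p (g • c s) with ht
  have htri1 := dist_triangle p (g • p) (g • c s)
  have htri2 := dist_triangle (g • p) p (g • c s)
  rw [dist_comm (g • p) p] at htri2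
  -- The point `g • c s` is far from `g • p`, hence it is close to the geodesics from `p` to
  -- `g • u`.
  have hmid : gromovProduct (g • c s) p (g • u) ≤ δ := by
    have h1 := hδ.2 (g • c s) (g • p) p (g • u)
    have h2 : gromovProduct (g • c s) (g • p) (g • u) = 0 := by
      unfold gromovProduct
      rw [hpx, dist_comm (g • u), hxu, hpu]
      ring
    have h3 : δ < gromovProduct (g • c s) (g • p) p := by
      unfold gromovProduct
      rw [hpx, dist_comm (g • p) p]
      linarith
    rw [h2] at h1
    rcases min_le_iff.1 (by linarith : min _ _ ≤ δ) with h | h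
    · linarith
    · exact h
  have hsum : t + (dist p u - s) ≤ dist p (g • u) + 2 * δ := by
    unfold gromovProduct at hmid
    rw [dist_comm (g • u) (g • c s), hxu] at hmid
    linarith
  have hsum' : dist p (g • u) ≤ t + (dist p u - s) := by
    rw [← hxu]
    exact dist_triangle _ _ _
  have ht0 : 0 ≤ t := dist_nonneg
  refine ⟨t, abs_le.2 ⟨by linarith, by linarith⟩, abs_le.2 ⟨by linarith, by linarith⟩, ?_⟩
  have hpt : dist p (c t) = t := hc.dist_left ht0 (by linarith)
  have h1 : t - δ ≤ gromovProduct p (g • c s) (g • u) := by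
    unfold gromovProduct
    rw [hxu, dist_comm _ p, ← ht, dist_comm _ p]
    linarith
  have h2 : t - δ ≤ gromovProduct p (g • u) u := by
    rw [gromovProduct_comm]
    linarith
  have h3 : t - δ ≤ gromovProduct p u (c t) := by
    unfold gromovProduct
    rw [dist_comm u (c t), hc.dist_right ht0 (by linarith), dist_comm u p, dist_comm (c t) p, hpt]
    linarith
  have h4 := hδ.sub_le_of_three h1 h2 h3
  unfold gromovProduct at h4
  rw [dist_comm _ p, dist_comm _ p, hpt] at h4
  linarith

theorem IsHyperbolicWith.dist_smul_le_of_dist_le {δ : ℝ} (hδ : IsHyperbolicWith X δ) {c : ℝ → X}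
    {p u : X} (hc : IsGeodesicSegment c p u) {g : G} {D s : ℝ} (hD : dist p (g • p) ≤ D)
    (hs : D + δ < s) (hsu : s + D ≤ dist p u) (hg : s + D ≤ gromovProduct p u (g • u)) :
    dist (c s) (g • c s) ≤ D + 6 * δ := by
  obtain ⟨t, -, hts, hdist⟩ := hδ.exists_dist_smul_le hc hD hs hsu hg
  have hδ0 := hδ.1
  have hD0 : 0 ≤ D := dist_nonneg.trans hD
  have hts' := abs_le.1 hts
  have h := hc.2.2 t ⟨by linarith, by linarith⟩ s ⟨by linarith, by linarith⟩
  linarith [dist_triangle_right (c s) (g • c s) (c t), dist_comm (c s) (c t)]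

/-- The translation lengths of `g` and `g⁻¹` along an almost fixed direction cancel. -/
theorem IsHyperbolicWith.abs_shift_add_shift_inv_le {δ : ℝ} (hδ : IsHyperbolicWith X δ)
    {c : ℝ → X} {p u : X} (hc : IsGeodesicSegment c p u) {g : G} {D s : ℝ}
    (hD : dist p (g • p) ≤ D) (hs : 2 * D + δ < s) (hsu : s + 2 * D ≤ dist p u)
    (hg : s + 2 * D ≤ gromovProduct p u (g • u))
    (hg' : s + 2 * D ≤ gromovProduct p u (g⁻¹ • u)) :
    |(dist p (g • u) - dist p u) + (dist p (g⁻¹ • u) - dist p u)| ≤ 16 * δ := by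
  have hδ0 := hδ.1
  have hD0 : 0 ≤ D := dist_nonneg.trans hD
  obtain ⟨t, hts, htD, ht⟩ := hδ.exists_dist_smul_le hc (g := g⁻¹)
    ((dist_inv_smul_self p g).trans_le hD) (s := s) (by linarith) (by linarith) (by linarith)
  have htD' := abs_le.1 htD
  obtain ⟨r, hrt, hrD, hr⟩ := hδ.exists_dist_smul_le hc hD (s := t) (by linarith) (by linarith)
    (by linarith)
  have hrD' := abs_le.1 hrD
  have h1 : dist (c s) (g • c t) ≤ 6 * δ := by
    rwa [← dist_smul g, smul_inv_smul] at ht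
  have h2 := hc.2.2 s ⟨by linarith, by linarith⟩ r ⟨by linarith, by linarith⟩
  have h3 : |s - r| ≤ 12 * δ := by
    rw [← h2]
    linarith [dist_triangle (c s) (g • c t) (c r)]
  rw [abs_le] at *
  constructor <;> linarith

/-- The commutator of two isometries that almost fix a direction almost fixes the points in that
direction, by a constant that depends on the space only: translation lengths cancel. -/
theorem IsHyperbolicWith.dist_commutator_smul_le {δ : ℝ} (hδ : IsHyperbolicWith X δ) {c : ℝ → X}
    {p u : X} (hc : IsGeodesicSegment c p u) {a b : G} {D s : ℝ} (ha : dist p (a • p) ≤ D)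
    (hb : dist p (b • p) ≤ D) (hs : 4 * D + δ < s) (hsu : s + 4 * D ≤ dist p u)
    (hau : s + 4 * D ≤ gromovProduct p u (a • u))
    (hau' : s + 4 * D ≤ gromovProduct p u (a⁻¹ • u))
    (hbu : s + 4 * D ≤ gromovProduct p u (b • u))
    (hbu' : s + 4 * D ≤ gromovProduct p u (b⁻¹ • u)) :
    dist (c s) (⁅a, b⁆ • c s) ≤ 64 * δ := by
  have hδ0 := hδ.1
  have hD0 : 0 ≤ D := dist_nonneg.trans ha
  have hA := abs_le.1 (hδ.abs_shift_add_shift_inv_le hc ha (s := s) (by linarith) (by linarith)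
    (by linarith) (by linarith))
  have hB := abs_le.1 (hδ.abs_shift_add_shift_inv_le hc hb (s := s) (by linarith) (by linarith)
    (by linarith) (by linarith))
  obtain ⟨s1, h1, h1', hd1⟩ := hδ.exists_dist_smul_le hc (g := b⁻¹)
    ((dist_inv_smul_self p b).trans_le hb) (s := s) (by linarith) (by linarith) (by linarith)
  rw [abs_le] at h1 h1'
  obtain ⟨s2, h2, h2', hd2⟩ := hδ.exists_dist_smul_le hc (g := a⁻¹)
    ((dist_inv_smul_self p a).trans_le ha) (s := s1) (by linarith) (by linarith) (by linarith)
  rw [abs_le] at h2 h2'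
  obtain ⟨s3, h3, h3', hd3⟩ := hδ.exists_dist_smul_le hc hb (s := s2) (by linarith) (by linarith)
    (by linarith)
  rw [abs_le] at h3 h3'
  obtain ⟨s4, h4, h4', hd4⟩ := hδ.exists_dist_smul_le hc ha (s := s3) (by linarith) (by linarith)
    (by linarith)
  rw [abs_le] at h4 h4'
  have e4 : dist (c s4) (c s) ≤ 40 * δ := by
    rw [hc.2.2 s4 ⟨by linarith, by linarith⟩ s ⟨by linarith, by linarith⟩, abs_le]
    constructor <;> linarith
  have e1 : dist (a • b • a⁻¹ • b⁻¹ • c s) (a • b • a⁻¹ • c s1) ≤ 6 * δ := by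
    simpa only [dist_smul] using hd1
  have e2 : dist (a • b • a⁻¹ • c s1) (a • b • c s2) ≤ 6 * δ := by
    simpa only [dist_smul] using hd2
  have e3 : dist (a • b • c s2) (a • c s3) ≤ 6 * δ := by
    simpa only [dist_smul] using hd3
  have hcomm : ⁅a, b⁆ • c s = a • b • a⁻¹ • b⁻¹ • c s := by
    simp only [commutatorElement_def, mul_smul]
  rw [dist_comm, hcomm]
  linarith [dist_triangle4 (a • b • a⁻¹ • b⁻¹ • c s) (a • b • a⁻¹ • c s1) (a • b • c s2) (a • c s3),
    dist_triangle4 (a • b • a⁻¹ • b⁻¹ • c s) (a • c s3) (c s4) (c s)]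

end Geodesics

/-! ### Finiteness from acylindricity -/

section Acylindrical

variable {G : Type u} [Group G] {X : Type v} [MetricSpace X] [MulAction G X]

/-- In an acylindrical action only finitely many elements almost fix, with a common bound, the
points of a coarse ray pointwise. -/
theorem IsAcylindricalAction.finite_of_dist_le [IsGeodesicSpace X]
    (hacyl : IsAcylindricalAction G X) {p : X} {u : ℕ → X}
    (hu : Tendsto (fun n => dist p (u n)) atTop atTop) {S : Set G} {ε : ℝ} (hε : 0 < ε)
    (hS : ∀ g ∈ S, ∀ᶠ s : ℝ in atTop, ∀ᶠ n in atTop, ∀ c, IsGeodesicSegment c p (u n) →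
      dist (c s) (g • c s) ≤ ε) : S.Finite := by
  obtain ⟨M, N, hMN⟩ := hacyl ε hε
  by_contra hinf
  obtain ⟨T, hTS, hT⟩ := Set.Infinite.exists_subset_card_eq hinf (N + 1)
  have hev : ∀ᶠ s : ℝ in atTop, ∀ g ∈ T, ∀ᶠ n in atTop, ∀ c, IsGeodesicSegment c p (u n) →
      dist (c s) (g • c s) ≤ ε :=
    (eventually_all_finset T).2 fun g hg => hS g (hTS hg)
  obtain ⟨s, ⟨hs1, hs2⟩, hs0⟩ := ((hev.and ((tendsto_atTop_add_const_right atTop |M|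
    tendsto_id).eventually hev)).and (eventually_ge_atTop (0 : ℝ))).exists
  obtain ⟨n, ⟨hn1, hn2⟩, hn⟩ := ((((eventually_all_finset T).2 hs1).and
    ((eventually_all_finset T).2 hs2)).and (hu.eventually_ge_atTop (s + |M|))).exists
  obtain ⟨c, hc⟩ := IsGeodesicSpace.exists_geodesic p (u n)
  have hM := abs_nonneg M
  have hle := hMN (c s) (c (s + |M|)) (by
    rw [hc.2.2 s ⟨hs0, by linarith⟩ (s + |M|) ⟨by linarith, hn⟩, abs_sub_comm, add_sub_cancel_left,
      abs_abs]
    exact le_abs_self M)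
  have hcard := (Set.encard_le_encard (fun g hg => ⟨hn1 g hg c hc, hn2 g hg c hc⟩ :
    (T : Set G) ⊆ {g : G | dist (c s) (g • c s) ≤ ε ∧
      dist (c (s + |M|)) (g • c (s + |M|)) ≤ ε})).trans hle
  rw [Set.encard_coe_eq_coe_finsetCard, hT] at hcard
  exact absurd (Nat.cast_le.1 hcard) (by omega)

variable [IsIsometricSMul G X] [IsGromovHyperbolic X] [IsGeodesicSpace X]

/-- In an acylindrical action, a subgroup that almost fixes a direction has only finitely many
commutators. -/
theorem IsAcylindricalAction.finite_commutators (hacyl : IsAcylindricalAction G X)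
    (H : Subgroup G) {p : X} {u : ℕ → X}
    (hu : ∀ h ∈ H, Tendsto (fun n => gromovProduct p (u n) (h • u n)) atTop atTop) :
    {g : G | ∃ a ∈ H, ∃ b ∈ H, ⁅a, b⁆ = g}.Finite := by
  obtain ⟨δ, hδ⟩ := IsGromovHyperbolic.exists_isHyperbolicWith X
  have hu0 : Tendsto (fun n => dist p (u n)) atTop atTop := by
    refine (hu 1 H.one_mem).congr fun n => ?_
    rw [one_smul, gromovProduct_self, dist_comm]
  refine hacyl.finite_of_dist_le hu0 (ε := 64 * δ + 1) (by linarith [hδ.1]) ?_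
  rintro _ ⟨a, ha, b, hb, rfl⟩
  set D := max (dist p (a • p)) (dist p (b • p))
  filter_upwards [eventually_gt_atTop (4 * D + δ)] with s hs
  filter_upwards [hu0.eventually_ge_atTop (s + 4 * D), (hu a ha).eventually_ge_atTop (s + 4 * D),
    (hu b hb).eventually_ge_atTop (s + 4 * D),
    (hu a⁻¹ (H.inv_mem ha)).eventually_ge_atTop (s + 4 * D),
    (hu b⁻¹ (H.inv_mem hb)).eventually_ge_atTop (s + 4 * D)] with n h0 h1 h2 h3 h4 c hc
  linarith [hδ.dist_commutator_smul_le hc (le_max_left _ _) (le_max_right _ _) hs h0 h1 h3 h2 h4]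

end Acylindrical

/-! ### Stabilisers of boundary points -/

section Stabilisers

variable {G : Type u} [Group G] {X : Type v} [MetricSpace X] [MulAction G X] [IsIsometricSMul G X]
  [IsGromovHyperbolic X]

theorem tendsto_gromovProduct_smul_of_smul_eq {x : SeqAtInfinity X} {g : G}
    (hg : g • GromovBoundary.mk x = GromovBoundary.mk x) (p : X) :
    Tendsto (fun n => gromovProduct p (x.1 n) (g • x.1 n)) atTop atTop := by
  rw [GromovBoundary.smul_mk, GromovBoundary.mk_eq_mk] at hg
  refine tendsto_atTop.2 fun r => ?_
  obtain ⟨n, hn⟩ := hg.symm.exists_forall_le p r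
  filter_upwards [eventually_ge_atTop n] with i hi using hn i hi i hi

/-- The isometries that fix three given boundary points move a given point by a bounded amount. -/
theorem exists_forall_dist_smul_le_of_fixes_three {ξ η ζ : GromovBoundary X} (hξη : ξ ≠ η)
    (hξζ : ξ ≠ ζ) (hηζ : η ≠ ζ) (p : X) :
    ∃ C : ℝ, ∀ g : G, g • ξ = ξ → g • η = η → g • ζ = ζ → dist p (g • p) ≤ C := by
  obtain ⟨δ, hδ⟩ := IsGromovHyperbolic.exists_isHyperbolicWith X
  have hδ0 := hδ.1
  obtain ⟨x, rfl⟩ := GromovBoundary.exists_mk_eq ξ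
  obtain ⟨y, rfl⟩ := GromovBoundary.exists_mk_eq η
  obtain ⟨z, rfl⟩ := GromovBoundary.exists_mk_eq ζ
  rw [Ne, GromovBoundary.mk_eq_mk] at hξη hξζ hηζ
  obtain ⟨R1, n1, h1⟩ := exists_forall_gromovProduct_le x.2 y.2 hξη p
  obtain ⟨R2, n2, h2⟩ := exists_forall_gromovProduct_le x.2 z.2 hξζ p
  obtain ⟨R3, n3, h3⟩ := exists_forall_gromovProduct_le y.2 z.2 hηζ p
  set R := max R1 (max R2 R3)
  have hR1 : R1 ≤ R := le_max_left _ _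
  have hR2 : R2 ≤ R := (le_max_left _ _).trans (le_max_right _ _)
  have hR3 : R3 ≤ R := (le_max_right _ _).trans (le_max_right _ _)
  refine ⟨2 * (R + 2 * δ) + 2 * δ, fun g hx hy hz => ?_⟩
  -- If `g` almost fixes the directions from `g • p` to `a` and to `b`, then the product of `a` and
  -- `b` at `g • p` is almost that of `g • a` and `g • b`, which is that of `a` and `b` at `p`.
  have transfer : ∀ a b : X, gromovProduct p a b ≤ R →
      R + 2 * δ < gromovProduct (g • p) a (g • a) → R + 2 * δ < gromovProduct (g • p) b (g • b) →
      gromovProduct (g • p) a b ≤ R + 2 * δ := by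
    intro a b hab ha hb
    by_contra! h
    rw [gromovProduct_comm] at ha
    set r := min (gromovProduct (g • p) (g • a) a) (min (gromovProduct (g • p) a b)
      (gromovProduct (g • p) b (g • b)))
    have hr : R + 2 * δ < r := lt_min ha (lt_min h hb)
    have h4 := hδ.sub_le_of_three (r := r) (min_le_left _ _)
      ((min_le_right _ _).trans (min_le_left _ _)) ((min_le_right _ _).trans (min_le_right _ _))
    rw [gromovProduct_smul] at h4
    linarith
  obtain ⟨n, ⟨⟨⟨⟨hx', hy'⟩, hz'⟩, hn1⟩, hn2⟩, hn3⟩ :=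
    (((((((tendsto_gromovProduct_smul_of_smul_eq hx (g • p)).eventually_gt_atTop (R + 2 * δ)).and
      ((tendsto_gromovProduct_smul_of_smul_eq hy (g • p)).eventually_gt_atTop (R + 2 * δ))).and
      ((tendsto_gromovProduct_smul_of_smul_eq hz (g • p)).eventually_gt_atTop (R + 2 * δ))).and
      (eventually_ge_atTop n1)).and (eventually_ge_atTop n2)).and (eventually_ge_atTop n3)).exists
  have hxy := (h1 n hn1 n hn1).trans hR1
  have hxz := (h2 n hn2 n hn2).trans hR2
  have hyz := (h3 n hn3 n hn3).trans hR3
  exact hδ.dist_le_of_centers (hxy.trans (by linarith)) (hxz.trans (by linarith))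
    (hyz.trans (by linarith)) (transfer _ _ hxy hx' hy') (transfer _ _ hxz hx' hz')
    (transfer _ _ hyz hy' hz')

/-- In an acylindrical action the pointwise stabiliser of three boundary points is finite. -/
theorem IsAcylindricalAction.finite_setOf_fixes_three [IsGeodesicSpace X]
    (hacyl : IsAcylindricalAction G X) {ξ η ζ : GromovBoundary X} (hξη : ξ ≠ η)
    (hξζ : ξ ≠ ζ) (hηζ : η ≠ ζ) : {g : G | g • ξ = ξ ∧ g • η = η ∧ g • ζ = ζ}.Finite := by
  obtain ⟨δ, hδ⟩ := IsGromovHyperbolic.exists_isHyperbolicWith X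
  obtain ⟨x, rfl⟩ := GromovBoundary.exists_mk_eq ξ
  set p := x.1 0
  obtain ⟨C, hC⟩ := exists_forall_dist_smul_le_of_fixes_three (G := G) hξη hξζ hηζ p
  refine hacyl.finite_of_dist_le (x.2.tendsto_dist p) (ε := |C| + 6 * δ + 1)
    (by linarith [hδ.1, abs_nonneg C]) ?_
  rintro g ⟨hgξ, hgη, hgζ⟩
  have hg := (hC g hgξ hgη hgζ).trans (le_abs_self C)
  filter_upwards [eventually_gt_atTop (|C| + δ)] with s hs
  filter_upwards [(x.2.tendsto_dist p).eventually_ge_atTop (s + |C|),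
    (tendsto_gromovProduct_smul_of_smul_eq hgξ p).eventually_ge_atTop (s + |C|)] with n h1 h2 c hc
  linarith [hδ.dist_smul_le_of_dist_le hc hg hs h1 h2]

/-- A group with a subgroup of finite index that has only finitely many commutators has at most two
limit points. -/
theorem not_isNonElementaryAction_of_finite_commutators (H : Subgroup G) [H.FiniteIndex]
    (hH : {g : G | ∃ a ∈ H, ∃ b ∈ H, ⁅a, b⁆ = g}.Finite) : ¬ IsNonElementaryAction G X := by
  intro hne
  -- Finitely many right coset representatives.
  obtain ⟨F, hF, hHF⟩ : ∃ F : Set G, F.Finite ∧ ∀ g, ∃ h ∈ H, ∃ f ∈ F, h * f = g := by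
    refine ⟨Set.range fun q : G ⧸ H => q.out⁻¹, Set.finite_range _, fun g => ?_⟩
    refine ⟨g * ((g⁻¹ : G) : G ⧸ H).out, ?_, _, ⟨((g⁻¹ : G) : G ⧸ H), rfl⟩, by group⟩
    have h := QuotientGroup.eq.1 (QuotientGroup.out_eq' ((g⁻¹ : G) : G ⧸ H)).symm
    simpa using h
  -- Since `h * (k * f) = k * (h * ⁅h⁻¹, k⁻¹⁆ * f)` for `h`, `k` in `H` and `f` in `F`, an element
  -- of `H` moves the points of an orbit of `G` by a bounded amount.
  have hfix : ∀ ξ ∈ gromovLimitSet G X, ∀ h ∈ H, h • ξ = ξ := by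
    rintro _ ⟨p, t, ht, rfl⟩ h hh
    obtain ⟨C, hC⟩ := ((hH.prod hF).image fun kf : G × G =>
      dist (h • kf.1 • kf.2 • p) (kf.2 • p)).bddAbove
    have hdist : ∀ n, dist (t n • p) (h • t n • p) ≤ C := by
      intro n
      obtain ⟨k, hk, f, hf, hkf⟩ := hHF (t n)
      have heq : h * t n = k * (h * ⁅h⁻¹, k⁻¹⁆ * f) := by
        rw [← hkf, commutatorElement_def]
        group
      rw [← mul_smul, heq, ← hkf, mul_smul, mul_smul k, dist_smul, dist_comm, mul_smul, mul_smul]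
      exact hC ⟨(⁅h⁻¹, k⁻¹⁆, f), ⟨⟨_, H.inv_mem hh, _, H.inv_mem hk, rfl⟩, hf⟩, rfl⟩
    have hC0 : 0 ≤ C := dist_nonneg.trans (hdist 0)
    exact GromovBoundary.mk_eq_mk.2
      (ht.of_dist_le (fun n => (dist_self _).trans_le hC0) hdist).symm
  have h3 : (3 : ℕ∞) ≤ (gromovLimitSet G X).encard := by
    have h := Order.add_one_le_of_lt (show 2 < (gromovLimitSet G X).encard from hne)
    rwa [two_add_one_eq_three] at h
  obtain ⟨T, hTsub, hT⟩ := Set.exists_subset_encard_eq h3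
  obtain ⟨ξ, η, ζ, hξη, hξζ, hηζ, rfl⟩ := Set.encard_eq_three.1 hT
  have hξ := hTsub (Set.mem_insert ξ _)
  have hη := hTsub (Set.mem_insert_of_mem ξ (Set.mem_insert η _))
  have hζ := hTsub (Set.mem_insert_of_mem ξ (Set.mem_insert_of_mem η rfl))
  obtain ⟨p, t, ht, -⟩ := id hξ
  obtain ⟨C, hC⟩ := exists_forall_dist_smul_le_of_fixes_three (G := G) hξη hξζ hηζ p
  obtain ⟨C', hC'⟩ := (hF.image fun f => dist p (f • p)).bddAbove
  obtain ⟨n, hn⟩ := ((ht.tendsto_dist p).eventually_gt_atTop (C + C')).exists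
  obtain ⟨k, hk, f, hf, hkf⟩ := hHF (t n)
  have h1 := hC k (hfix ξ hξ k hk) (hfix η hη k hk) (hfix ζ hζ k hk)
  have h2 : dist p (f • p) ≤ C' := hC' ⟨f, hf, rfl⟩
  rw [← dist_smul k, ← mul_smul, hkf] at h2
  linarith [dist_triangle p (k • p) (t n • p)]

end Stabilisers

/-! ### Convergence dynamics on the boundary -/

section Convergence

variable {G : Type u} [Group G] {X : Type v} [MetricSpace X] [MulAction G X] [IsIsometricSMul G X]
  [IsGromovHyperbolic X]

/-- If `g n • p → ξ` and `(g n)⁻¹ • p → η`, then `g n` maps the complement of any neighbourhood of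
`η` into any given neighbourhood of `ξ`, for large `n`. -/
theorem TendstoBoundary.eventually_smul_mem {p : X} {g : ℕ → G} {ξ η : GromovBoundary X}
    (hξ : TendstoBoundary (fun n => g n • p) ξ) (hη : TendstoBoundary (fun n => (g n)⁻¹ • p) η)
    {N V : Set (GromovBoundary X)} (hN : N ∈ 𝓝 η) (hV : V ∈ 𝓝 ξ) :
    ∀ᶠ n in atTop, ∀ θ ∉ N, g n • θ ∈ V := by
  obtain ⟨δ, hδ⟩ := IsGromovHyperbolic.exists_isHyperbolicWith X
  obtain ⟨r, hr⟩ := GromovBoundary.exists_setOf_le_product_subset p hN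
  obtain ⟨s, hs⟩ := GromovBoundary.exists_setOf_le_product_subset p hV
  obtain ⟨hx, rfl⟩ := hξ
  obtain ⟨hy, rfl⟩ := hη
  obtain ⟨a, ha⟩ := hy.exists_forall_le p (r + 2 * δ)
  obtain ⟨b, hb⟩ := hx.exists_forall_le p (s + δ)
  filter_upwards [eventually_ge_atTop a, eventually_ge_atTop b,
    (hx.tendsto_dist p).eventually_ge_atTop (s + δ + (r + 2 * δ))] with n hna hnb hnd θ hθ
  obtain ⟨z, rfl⟩ := GromovBoundary.exists_mk_eq θ
  have hbdd : ∃ k, ∀ j ≥ k, gromovProduct p ((g n)⁻¹ • p) (z.1 j) ≤ r + 2 * δ := by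
    by_contra! hunb
    refine hθ (hr ?_)
    obtain ⟨c, hc⟩ := z.2.exists_forall_le p (r + 2 * δ)
    obtain ⟨j, hj, hjz⟩ := hunb c
    refine GromovBoundary.le_product (n := max a c) fun i hi l hl => ?_
    linarith [hδ.sub_le_of_three (ha i (le_of_max_le_left hi) n hna) hjz.le
      (hc j hj l (le_of_max_le_right hl))]
  obtain ⟨k, hk⟩ := hbdd
  refine hs ?_
  rw [Set.mem_ofPred_eq, GromovBoundary.smul_mk]
  refine GromovBoundary.le_product (n := max b k) fun i hi j hj => ?_
  have h1 := hb i (le_of_max_le_left hi) n hnb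
  have h2 := gromovProduct_add_gromovProduct p (g n • p) (g n • z.1 j)
  have h3 : gromovProduct (g n • p) p (g n • z.1 j) = gromovProduct p ((g n)⁻¹ • p) (z.1 j) := by
    rw [← gromovProduct_smul (g n) p, smul_inv_smul]
  have h4 := hk j (le_of_max_le_right hj)
  have h5 : s + δ ≤ gromovProduct p (g n • p) (g n • z.1 j) := by linarith
  have h6 := hδ.sub_le h1 h5
  simp only [SeqAtInfinity.translate]
  linarith

/-- Conjugates of `h` by elements `a n` with `a n • p → ζ` move `p` towards `ζ` as well, when `h`
does not almost fix the direction from `p` to `(a n)⁻¹ • p`. -/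
theorem TendstoBoundary.conj_smul {p : X} {a : ℕ → G} {ζ : GromovBoundary X}
    (ha : TendstoBoundary (fun n => a n • p) ζ) {h : G} {R : ℝ}
    (hR : ∀ n, gromovProduct p ((a n)⁻¹ • p) (h • (a n)⁻¹ • p) ≤ R) :
    TendstoBoundary (fun n => (a n * h * (a n)⁻¹) • p) ζ := by
  obtain ⟨δ, hδ⟩ := IsGromovHyperbolic.exists_isHyperbolicWith X
  refine ha.of_gromovProductTendsto (.of_forall_exists p fun r => ?_)
  obtain ⟨b, hb⟩ := ha.1.exists_forall_le p (r + δ)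
  obtain ⟨c, hc⟩ := eventually_atTop.1 ((ha.1.tendsto_dist p).eventually_ge_atTop (r + δ + R))
  refine ⟨max b c, fun i hi j hj => ?_⟩
  have h1 := hb i (le_of_max_le_left hi) j (le_of_max_le_left hj)
  have h2 := gromovProduct_add_gromovProduct p (a j • p) ((a j * h * (a j)⁻¹) • p)
  have h3 := hR j
  rw [← gromovProduct_smul (a j), smul_inv_smul, ← mul_smul, ← mul_smul] at h3
  have h4 := hc j (le_of_max_le_right hj)
  have h5 : r + δ ≤ gromovProduct p (a j • p) ((a j * h * (a j)⁻¹) • p) := by linarith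
  linarith [hδ.sub_le h1 h5]

theorem IsCoboundedAction.exists_tendstoBoundary (hcob : IsCoboundedAction G X) (p : X)
    (ζ : GromovBoundary X) : ∃ a : ℕ → G, TendstoBoundary (fun n => a n • p) ζ := by
  obtain ⟨z, rfl⟩ := GromovBoundary.exists_mk_eq ζ
  obtain ⟨B, hB, hcov⟩ := hcob
  obtain ⟨C, hC⟩ := (Metric.isBounded_iff_subset_closedBall p).1 hB
  have hex : ∀ n, ∃ g : G, dist (z.1 n) (g • p) ≤ C := by
    intro n
    obtain ⟨g, b, hb, hgb⟩ := hcov (z.1 n)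
    exact ⟨g, by rw [← hgb, dist_smul]; exact hC hb⟩
  choose a ha using hex
  have hC0 : 0 ≤ C := dist_nonneg.trans (ha 0)
  exact ⟨a, TendstoBoundary.of_gromovProductTendsto ⟨z.2, rfl⟩
    (z.2.of_dist_le (fun n => (dist_self _).trans_le hC0) ha)⟩

end Convergence

/-! ### Limits and orbits of boundary points -/

section Acylindrical

variable {G : Type u} [Group G] {X : Type v} [MetricSpace X] [MulAction G X] [IsIsometricSMul G X]
  [IsGromovHyperbolic X] [IsGeodesicSpace X]

/-- When the group has infinitely many commutators, every boundary point is both the limit of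
`g n • p` and the limit of `(g n)⁻¹ • p` for some sequence `g` in the group. -/
theorem exists_tendstoBoundary_smul_and_inv_smul (hacyl : IsAcylindricalAction G X)
    (hcob : IsCoboundedAction G X)
    (hcomm : ¬ {g : G | ∃ a ∈ (⊤ : Subgroup G), ∃ b ∈ (⊤ : Subgroup G), ⁅a, b⁆ = g}.Finite)
    (p : X) (ζ : GromovBoundary X) :
    ∃ g : ℕ → G, TendstoBoundary (fun n => g n • p) ζ ∧
      TendstoBoundary (fun n => (g n)⁻¹ • p) ζ := by
  obtain ⟨a, ha⟩ := hcob.exists_tendstoBoundary p ζ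
  -- Not every element of the group almost fixes the directions from `p` to `(a n)⁻¹ • p`.
  have hex : ∃ h : G,
      ¬ Tendsto (fun n => gromovProduct p ((a n)⁻¹ • p) (h • (a n)⁻¹ • p)) atTop atTop := by
    by_contra! hall
    exact hcomm (hacyl.finite_commutators ⊤ (p := p) (u := fun n => (a n)⁻¹ • p)
      fun h _ => hall h)
  obtain ⟨h, hh⟩ := hex
  rw [tendsto_atTop, not_forall] at hh
  obtain ⟨R, hR⟩ := hh
  obtain ⟨φ, hφ, hφR⟩ := extraction_of_frequently_atTop (not_eventually.1 hR)
  simp only [not_le] at hφR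
  have haφ : TendstoBoundary (fun n => a (φ n) • p) ζ := ha.comp_strictMono hφ
  refine ⟨fun n => a (φ n) * h * (a (φ n))⁻¹, haφ.conj_smul fun n => (hφR n).le, ?_⟩
  have hinv : ∀ n, (a (φ n) * h * (a (φ n))⁻¹)⁻¹ = a (φ n) * h⁻¹ * (a (φ n))⁻¹ := by
    intro n
    group
  simp only [hinv]
  refine haφ.conj_smul (R := R + dist (h • p) p) fun n => ?_
  rw [← gromovProduct_smul h, smul_inv_smul, gromovProduct_comm]
  linarith [gromovProduct_le_add_dist_base (h • p) p ((a (φ n))⁻¹ • p) (h • (a (φ n))⁻¹ • p),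
    hφR n]

/-- A boundary point with a finite orbit would be fixed by a subgroup of finite index, which would
then have only finitely many commutators. -/
theorem IsAcylindricalAction.infinite_orbit (hacyl : IsAcylindricalAction G X)
    (hcomm : ∀ H : Subgroup G, H.FiniteIndex → ¬ {g : G | ∃ a ∈ H, ∃ b ∈ H, ⁅a, b⁆ = g}.Finite)
    (ζ : GromovBoundary X) : (MulAction.orbit G ζ).Infinite := by
  intro hfin
  have := hfin.to_subtype
  have := Finite.of_equiv _ (MulAction.orbitEquivQuotientStabilizer G ζ)
  refine hcomm (MulAction.stabilizer G ζ) Subgroup.finiteIndex_of_finite_quotient ?_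
  obtain ⟨x, rfl⟩ := GromovBoundary.exists_mk_eq ζ
  exact hacyl.finite_commutators _ (p := x.1 0) fun h hh =>
    tendsto_gromovProduct_smul_of_smul_eq hh _

end Acylindrical

/-! ### Measures on the boundary -/

section Measures

variable {G : Type u} [Group G] {X : Type v} [MetricSpace X] [MulAction G X] [IsIsometricSMul G X]
  [IsGromovHyperbolic X]

/-- Some group element maps the complement of a set of small measure into a given neighbourhood of
`ζ`. The exceptional set can be taken around any point in the orbit of `ζ`, and among sufficiently
many disjoint neighbourhoods of such points one has small mass. -/
theorem TendstoBoundary.exists_forall_notMem_smul_mem {p : X} {g : ℕ → G} {ζ : GromovBoundary X}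
    (hg : TendstoBoundary (fun n => g n • p) ζ) (hg' : TendstoBoundary (fun n => (g n)⁻¹ • p) ζ)
    (hinf : (MulAction.orbit G ζ).Infinite) (μ : Measure (GromovBoundary X)) [IsFiniteMeasure μ]
    {ε : ENNReal} (hε : ε ≠ 0) {V : Set (GromovBoundary X)} (hV : V ∈ 𝓝 ζ) :
    ∃ (t : G) (O : Set (GromovBoundary X)), μ O ≤ ε ∧ ∀ θ ∉ O, t • θ ∈ V := by
  obtain ⟨k, hk⟩ := ENNReal.exists_nat_mul_gt hε (measure_ne_top μ Set.univ)
  obtain ⟨T, hT, hTk⟩ := hinf.exists_subset_card_eq k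
  obtain ⟨U, hU, hdisj⟩ := T.finite_toSet.t2_separation
  have hTne : T.Nonempty := by
    rw [← Finset.card_pos, hTk, Nat.pos_iff_ne_zero]
    rintro rfl
    simp at hk
  obtain ⟨x, hx, hxε⟩ : ∃ x ∈ T, μ (U x) ≤ ε := by
    refine ENNReal.exists_le_of_sum_le hTne (f := fun x => μ (U x)) (g := fun _ => ε) ?_
    rw [Finset.sum_const, hTk, nsmul_eq_mul]
    refine le_trans (sum_measure_le_measure_univ
      (fun y _ => (hU y).2.measurableSet.nullMeasurableSet) ?_) hk.le
    exact fun y hy z hz hyz => (hdisj hy hz hyz).aedisjoint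
  obtain ⟨f, rfl⟩ := hT hx
  have hN : (fun θ => f • θ) ⁻¹' U (f • ζ) ∈ 𝓝 ζ :=
    (continuous_const_smul f).continuousAt.preimage_mem_nhds ((hU _).2.mem_nhds (hU _).1)
  obtain ⟨n, hn⟩ := (hg.eventually_smul_mem hg' hN hV).exists
  refine ⟨g n * f⁻¹, U (f • ζ), hxε, fun θ hθ => ?_⟩
  rw [mul_smul]
  exact hn _ (by rwa [Set.mem_preimage, smul_inv_smul])

/-- If `t n` maps all but a set of vanishing measure into shrinking neighbourhoods of `ζ`, then it
pushes the measure to the Dirac mass at `ζ`. -/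
theorem tendsto_smul_dirac {B : Type v} [TopologicalSpace B] [MulAction G B]
    [ContinuousConstSMul G B] [MeasurableSpace B] [BorelSpace B] {ζ : B} (μ : ProbabilityMeasure B)
    {t : ℕ → G} {O V : ℕ → Set B} (hO : Tendsto (fun n => (μ : Measure B) (O n)) atTop (𝓝 0))
    (hV : ∀ W ∈ 𝓝 ζ, ∀ᶠ n in atTop, V n ⊆ W) (ht : ∀ n, ∀ θ ∉ O n, t n • θ ∈ V n) :
    Tendsto (fun n => t n • μ) atTop
      (𝓝 (⟨Measure.dirac ζ, inferInstance⟩ : ProbabilityMeasure B)) := by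
  refine tendsto_of_forall_isOpen_le_liminf' fun W hW => ?_
  by_cases hζ : ζ ∈ W
  · have hone : Measure.dirac ζ W ≤ 1 := prob_le_one
    have hlim : Tendsto (fun n => 1 - (μ : Measure B) (O n)) atTop (𝓝 1) := by
      have h := ENNReal.Tendsto.sub (tendsto_const_nhds (x := (1 : ENNReal)) (f := atTop (α := ℕ)))
        hO (Or.inl ENNReal.one_ne_top)
      rwa [tsub_zero] at h
    refine hone.trans (hlim.liminf_eq.ge.trans (liminf_le_liminf ?_))
    filter_upwards [hV W (hW.mem_nhds hζ)] with n hn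
    change _ ≤ Measure.map (fun b => t n • b) (μ : Measure B) W
    rw [Measure.map_apply (continuous_const_smul (t n)).measurable hW.measurableSet,
      tsub_le_iff_right, ← measure_univ (μ := (μ : Measure B))]
    refine le_trans (measure_mono fun θ _ => ?_) (measure_union_le _ _)
    by_cases hθ : θ ∈ O n
    · exact Or.inr hθ
    · exact Or.inl (hn (ht n θ hθ))
  · change Measure.dirac ζ W ≤ _
    rw [Measure.dirac_apply' _ hW.measurableSet, Set.indicator_of_notMem hζ]
    exact zero_le

/-- The neighbourhoods `{η | n ≤ (ζ · η)_p}` of `ζ` and their exceptional sets of measure at most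
`1 / n` yield one sequence for both measures, since smallness is imposed on `μ + ν`. -/
theorem TendstoBoundary.exists_tendsto_smul_dirac {p : X} {g : ℕ → G} {ζ : GromovBoundary X}
    (hg : TendstoBoundary (fun n => g n • p) ζ) (hg' : TendstoBoundary (fun n => (g n)⁻¹ • p) ζ)
    (hinf : (MulAction.orbit G ζ).Infinite) (μ ν : ProbabilityMeasure (GromovBoundary X)) :
    ∃ (t : ℕ → G) (κ : ProbabilityMeasure (GromovBoundary X)),
      Tendsto (fun n => t n • μ) atTop (𝓝 κ) ∧ Tendsto (fun n => t n • ν) atTop (𝓝 κ) := by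
  have hex : ∀ n : ℕ, ∃ (t : G) (O : Set (GromovBoundary X)),
      ((μ : Measure (GromovBoundary X)) + ν) O ≤ (n : ENNReal)⁻¹ ∧
        ∀ θ ∉ O, t • θ ∈ {η | ((n : ℝ) : EReal) ≤ GromovBoundary.product p ζ η} := fun n =>
    hg.exists_forall_notMem_smul_mem hg' hinf _ (ENNReal.inv_ne_zero.2 (ENNReal.natCast_ne_top n))
      (GromovBoundary.setOf_le_product_mem_nhds p ζ n)
  choose t O hO ht using hex
  have hV : ∀ W ∈ 𝓝 ζ, ∀ᶠ n : ℕ in atTop,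
      {η | ((n : ℝ) : EReal) ≤ GromovBoundary.product p ζ η} ⊆ W := by
    intro W hW
    obtain ⟨r, hr⟩ := GromovBoundary.exists_setOf_le_product_subset p hW
    filter_upwards [eventually_ge_atTop ⌈r⌉₊] with n hn
    exact fun η hη => hr (le_trans (EReal.coe_le_coe_iff.2 (Nat.ceil_le.1 hn)) hη)
  have hlim := ENNReal.tendsto_inv_nat_nhds_zero
  refine ⟨t, _, tendsto_smul_dirac μ ?_ hV ht, tendsto_smul_dirac ν ?_ hV ht⟩
  · exact tendsto_of_tendsto_of_tendsto_of_le_of_le tendsto_const_nhds hlim (fun n => zero_le)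
      fun n => (le_add_right le_rfl).trans (hO n)
  · exact tendsto_of_tendsto_of_tendsto_of_le_of_le tendsto_const_nhds hlim (fun n => zero_le)
      fun n => (le_add_left le_rfl).trans (hO n)

end Measures

/-! ### Minimality, strong proximality and topological freeness -/

section Main

variable {G : Type u} [Group G] {X : Type v} [MetricSpace X] [MulAction G X] [IsIsometricSMul G X]
  [IsGromovHyperbolic X] [IsGeodesicSpace X]

/-- An element that fixes a neighbourhood of `ζ` has a conjugate that fixes the whole boundary: its
conjugates by `(g n)⁻¹` eventually fix any given point other than `ζ`, and only finitely many group
elements fix three given points. -/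
theorem IsAcylindricalAction.interior_fixedBy_eq_empty (hacyl : IsAcylindricalAction G X)
    (hfin : ∀ N : Subgroup G, N.Normal → Finite N → N = ⊥) {p : X}
    (hlim : ∀ ζ : GromovBoundary X, ∃ g : ℕ → G, TendstoBoundary (fun n => g n • p) ζ ∧
      TendstoBoundary (fun n => (g n)⁻¹ • p) ζ)
    (hinf : ∀ ζ : GromovBoundary X, (MulAction.orbit G ζ).Infinite) {k : G} (hk : k ≠ 1) :
    interior (MulAction.fixedBy (GromovBoundary X) k) = ∅ := by
  by_contra hne
  obtain ⟨ζ, hζ⟩ := Set.nonempty_iff_ne_empty.2 hne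
  obtain ⟨g, hg, hg'⟩ := hlim ζ
  have hfix : ∀ θ, θ ≠ ζ → ∀ᶠ n in atTop, ((g n)⁻¹ * k * g n) • θ = θ := by
    intro θ hθ
    filter_upwards [hg.eventually_smul_mem hg' (isOpen_ne.mem_nhds hθ.symm)
      (mem_interior_iff_mem_nhds.1 hζ)] with n hn
    rw [mul_smul, mul_smul, inv_smul_eq_iff]
    exact hn θ fun h => h rfl
  classical
  obtain ⟨T, hT, hT3⟩ := ((hinf ζ).sdiff (Set.finite_singleton ζ)).exists_subset_card_eq 3
  obtain ⟨x, y, z, hxy, hxz, hyz, rfl⟩ := Finset.card_eq_three.1 hT3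
  have hx := (hT (show x ∈ _ by simp)).2
  have hy := (hT (show y ∈ _ by simp)).2
  have hz := (hT (show z ∈ _ by simp)).2
  have hK := hacyl.finite_setOf_fixes_three hxy hxz hyz
  -- One conjugate occurs infinitely often.
  obtain ⟨c, -, hc⟩ : ∃ c ∈ {h : G | h • x = x ∧ h • y = y ∧ h • z = z},
      ∃ᶠ n in atTop, (g n)⁻¹ * k * g n = c := by
    by_contra! hrare
    obtain ⟨n, ⟨⟨h1, h2⟩, h3⟩, h4⟩ := ((((hfix x hx).and (hfix y hy)).and (hfix z hz)).and
      ((eventually_all_finite hK).2 hrare)).exists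
    exact h4 _ ⟨h1, h2, h3⟩ rfl
  have hcfix : ∀ θ, θ ≠ ζ → c • θ = θ := by
    intro θ hθ
    obtain ⟨n, rfl, hn⟩ := (hc.and_eventually (hfix θ hθ)).exists
    exact hn
  have hcζ : c • ζ = ζ := by
    by_contra h
    exact h (smul_left_cancel c (hcfix _ h))
  have hker : (MulAction.toPermHom G (GromovBoundary X)).ker = ⊥ := by
    refine hfin _ inferInstance (hK.subset fun h hh => ?_)
    have hh' : ∀ θ : GromovBoundary X, h • θ = θ := fun θ =>
      congrArg (fun e : Equiv.Perm (GromovBoundary X) => e θ) (MonoidHom.mem_ker.1 hh)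
    exact ⟨hh' x, hh' y, hh' z⟩
  have hc1 : c = 1 := by
    rw [← Subgroup.mem_bot, ← hker, MonoidHom.mem_ker]
    ext θ
    by_cases h : θ = ζ
    · rw [h]
      exact hcζ
    · exact hcfix θ h
  obtain ⟨n, hn⟩ := hc.exists
  refine hk ?_
  rw [hc1, mul_assoc, inv_mul_eq_one] at hn
  exact mul_eq_right.1 hn.symm

end Main

theorem mainTheorem5 {G : Type u} [Group G]
    (hG : IsAcylindricallyHyperbolic.{u, w} G)
    (hfin : ∀ N : Subgroup G, N.Normal → Finite N → N = ⊥)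
    {X : Type v} [MetricSpace X] [IsGromovHyperbolic X] [IsGeodesicSpace X]
    [MulAction G X] [IsIsometricSMul G X]
    (hacyl : IsAcylindricalAction G X) (hcob : IsCoboundedAction G X) :
    MulAction.IsMinimal G (GromovBoundary X) ∧
      IsStronglyProximalAction G (GromovBoundary X) ∧
      IsTopologicallyFreeAction G (GromovBoundary X) := by
  obtain ⟨Y, _, _, _, _, _, hne, -, -⟩ := hG
  have hcomm : ∀ H : Subgroup G, H.FiniteIndex →
      ¬ {g : G | ∃ a ∈ H, ∃ b ∈ H, ⁅a, b⁆ = g}.Finite := fun H _ hH =>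
    not_isNonElementaryAction_of_finite_commutators (X := Y) H hH hne
  have hinf := hacyl.infinite_orbit hcomm
  have hlim := exists_tendstoBoundary_smul_and_inv_smul hacyl hcob
    (hcomm ⊤ inferInstance)
  refine ⟨⟨fun ξ ζ => mem_closure_iff_nhds.2 fun V hV => ?_⟩, fun μ ν => ?_, fun k hk => ?_⟩
  · obtain ⟨x, -⟩ := GromovBoundary.exists_mk_eq ξ
    obtain ⟨g, hg, hg'⟩ := hlim (x.1 0) ζ
    by_cases h : ξ = ζ
    · exact ⟨ζ, mem_of_mem_nhds hV, h ▸ MulAction.mem_orbit_self ξ⟩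
    · obtain ⟨n, hn⟩ := (hg.eventually_smul_mem hg' (isOpen_ne.mem_nhds (Ne.symm h)) hV).exists
      exact ⟨g n • ξ, hn ξ fun h' => h' rfl, MulAction.mem_orbit ξ (g n)⟩
  · obtain ⟨ζ⟩ := (μ : Measure (GromovBoundary X)).nonempty_of_neZero
    obtain ⟨x, -⟩ := GromovBoundary.exists_mk_eq ζ
    obtain ⟨g, hg, hg'⟩ := hlim (x.1 0) ζ
    exact hg.exists_tendsto_smul_dirac hg' (hinf ζ) μ ν
  · by_contra hint
    obtain ⟨ζ, -⟩ := Set.nonempty_iff_ne_empty.2 hint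
    obtain ⟨x, -⟩ := GromovBoundary.exists_mk_eq ζ
    exact hint (hacyl.interior_fixedBy_eq_empty hfin (hlim (x.1 0)) hinf hk)
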